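/- Let $k$ be an algebraically closed field, $R$ a finite-dimensional $k$-algebra, $R\text{-}\mathsf{mod}$ the category of finitely generated left $R$-modules, and $R\text{-}\underline{\mathsf{mod}}$ its stable category: the same objects, and morphism spaces $\underline{\mathrm{Hom}}_R(X,Y)=\mathrm{Hom}_R(X,Y)/\mathcal P(X,Y)$, where $\mathcal P(X,Y)$ consists of the maps that factor through a projective module. It is left triangulated, the left triangles $\Omega Z\to X\to Y\to Z$ being the diagrams isomorphic to those induced by short exact sequences $0\to X\to Y\to Z\to 0$ of modules. A family $\mathcal S$ of objects of $R\text{-}\underline{\mathsf{mod}}$ is an *orthogonal system* if $\underline{\mathrm{Hom}}_R(S,S)\cong k$ for every $S\in\mathcal S$ and $\underline{\mathrm{Hom}}_R(S,S')=0$ for distinct $S,S'\in\mathcal S$. Let $\mathcal A\star\mathcal B$ be the class of objects $X$ that occur in a left triangle $\Omega B\to A\to X\to B$ with $A\in\mathcal A$, $B\in\mathcal B$; put $(\mathcal S)_0=\{0\}$ and $(\mathcal S)_{n}=(\mathcal S)_{n-1}\star(\mathcal S\cup\{0\})$. Let $\mathcal F(\mathcal S)$ be the class of all direct summands in $R\text{-}\underline{\mathsf{mod}}$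 of objects of $\bigcup_{n\ge 0}(\mathcal S)_n$ (the closure of $\mathcal S$ under extensions and direct summands), and let $F(\mathcal S,R)$ be the class of finitely generated modules that lie in $\mathcal F(\mathcal S)$ as objects of $R\text{-}\underline{\mathsf{mod}}$; it contains the finitely generated projective modules. An orthogonal system $\mathcal S$ is a *weakly simple-minded system* if for every non-zero object $X$ of $R\text{-}\underline{\mathsf{mod}}$ there is $S\in\mathcal S$ with $\underline{\mathrm{Hom}}_R(X,S)\neq 0$, and a *simple-minded system* if $\mathcal F(\mathcal S)=R\text{-}\underline{\mathsf{mod}}$. A class $\mathcal X$ of objects is *covariantly finite* if every object $Y$ has a morphism $Y\to X$ with $X\in\mathcal X$ through which every morphism from $Y$ to an object of $\mathcal X$ factors. A *homogeneous tube* is a component of the Auslander–Reiten quiver of $R$ of the form $\mathbb Z A_\infty/\langle\tau\rangle$. A ring is *right coherent* if its finitely generated right ideals are finitely presented. **Theorem.** Let $\mathcal S$ be an orthogonal system in $R\text{-}\underline{\mathsf{mod}}$. Let $M=\bigoplus_{j} M_j$, where $(M_j)_j$ is a family of modules in $F(\mathcal S,R)$ such that every module in $F(\mathcal S,R)$ is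 isomorphic to some $M_j$ (for instance one module from each isomorphism class), and let $E=\mathrm{End}_R(M)$, with endomorphisms written on the right, so that $M$ is a right $E$-module. 1. If $E$ is right coherent and $M$ is finendo (finitely generated as a right $E$-module), then $\mathcal F(\mathcal S)$ is covariantly finite in $R\text{-}\underline{\mathsf{mod}}$. 2. If $E$ is right coherent, $M$ is finendo, and $\mathcal S$ is a weakly simple-minded system that contains no object of any homogeneous tube, then $\mathcal S$ is a simple-minded system. -/

import Mathlib

universe u v w x

/-- A finitely generated left `R`-module over a `k`-algebra `R`, with its induced `k`-structure.
For a finite-dimensional algebra these are the finitely presented modules, i.e. the objects of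
`R-mod` and of the stable category. -/
structure FinMod (k : Type v) (R : Type u) [Field k] [Ring R] [Algebra k R] where
  carrier : Type u
  [addCommGroup : AddCommGroup carrier]
  [moduleR : Module R carrier]
  [modulek : Module k carrier]
  [tower : IsScalarTower k R carrier]
  [finite : Module.Finite R carrier]

namespace FinMod

variable {k : Type v} {R : Type u} [Field k] [Ring R] [Algebra k R]

instance : CoeSort (FinMod k R) (Type u) := ⟨FinMod.carrier⟩

attribute [instance] addCommGroup moduleR modulek tower finite

/-- The direct sum of two modules. -/
def prod (X Y : FinMod k R) : FinMod k R where
  carrier := X × Y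

/-- The `R`-linear map `f` factors through a projective `R`-module. -/
def FactorsProj {X Y : FinMod k R} (f : X →ₗ[R] Y) : Prop :=
  ∃ (P : Type u) (_ : AddCommGroup P) (_ : Module R P) (_ : Module.Projective R P)
    (a : X →ₗ[R] P) (b : P →ₗ[R] Y), b ∘ₗ a = f

/-- The subspace `𝒫(X, Y)` of the maps that factor through a projective module. -/
def projMaps (X Y : FinMod k R) : Submodule k (X →ₗ[R] Y) where
  carrier := {f | FactorsProj f}
  add_mem' := by
    rintro f g ⟨P, _, _, _, a, b, rfl⟩ ⟨Q, _, _, _, c, d, rfl⟩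
    refine ⟨P × Q, inferInstance, inferInstance, inferInstance, a.prod c, b.coprod d, ?_⟩
    ext x
    simp
  zero_mem' := ⟨PUnit, inferInstance, inferInstance, inferInstance, 0, 0, by simp⟩
  smul_mem' := by
    rintro c f ⟨P, _, _, _, a, b, rfl⟩
    exact ⟨P, inferInstance, inferInstance, inferInstance, a, c • b, by ext x; simp⟩

/-- The space of morphisms from `X` to `Y` in the stable category. -/
abbrev StableHom (X Y : FinMod k R) : Type _ := (X →ₗ[R] Y) ⧸ projMaps X Y

/-- Two maps have the same class in the stable category. -/
def StableEq {X Y : FinMod k R} (f g : X →ₗ[R] Y) : Prop := f - g ∈ projMaps X Y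

/-- `X` and `Y` are isomorphic in the stable category. -/
def StableIso (X Y : FinMod k R) : Prop :=
  ∃ (f : X →ₗ[R] Y) (g : Y →ₗ[R] X),
    StableEq (g ∘ₗ f) LinearMap.id ∧ StableEq (f ∘ₗ g) LinearMap.id

/-- `X` is a zero object of the stable category, i.e. its identity is stably zero. -/
def StablyZero (X : FinMod k R) : Prop := (LinearMap.id : X →ₗ[R] X) ∈ projMaps X X

/-- `0 → A → E → B → 0` is a short exact sequence. -/
def ShortExact {A E B : FinMod k R} (f : A →ₗ[R] E) (g : E →ₗ[R] B) : Prop :=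
  Function.Injective f ∧ Function.Exact f g ∧ Function.Surjective g

/-- `𝒜 ⋆ ℬ`: the objects `X` of the stable category for which there is a left triangle
`ΩB → A → X → B` with `A ∈ 𝒜` and `B ∈ ℬ`. The left triangles are the diagrams isomorphic, in the
stable category, to those given by short exact sequences of modules. -/
def Star (𝒜 ℬ : FinMod k R → Prop) (X : FinMod k R) : Prop :=
  ∃ (A B A' X' B' : FinMod k R) (f : A' →ₗ[R] X') (g : X' →ₗ[R] B'),
    𝒜 A ∧ ℬ B ∧ ShortExact f g ∧ StableIso A' A ∧ StableIso X' X ∧ StableIso B' B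

/-- The class `(𝒮)ₙ`: `(𝒮)₀ = {0}` and `(𝒮)ₙ₊₁ = (𝒮)ₙ ⋆ (𝒮 ∪ {0})`. -/
def stage {ι : Type w} (S : ι → FinMod k R) : ℕ → FinMod k R → Prop
  | 0 => StablyZero
  | n + 1 => Star (stage S n) (fun B => (∃ i, B = S i) ∨ StablyZero B)

/-- The closure `ℱ(𝒮)` of `𝒮` under extensions and direct summands in the stable category: the
direct summands of the objects of `⋃ₙ (𝒮)ₙ`. As a class of modules it is also the preimage
`F(𝒮, R)` of `ℱ(𝒮)` in the category of finitely generated modules; it contains the projectives. -/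
def ExtClosure {ι : Type w} (S : ι → FinMod k R) (X : FinMod k R) : Prop :=
  ∃ (n : ℕ) (Y Z : FinMod k R), stage S n Z ∧ StableIso (X.prod Y) Z

/-- A family of pairwise orthogonal stable bricks. -/
def IsOrthogonalSystem {ι : Type w} (S : ι → FinMod k R) : Prop :=
  (∀ i, Nonempty (StableHom (S i) (S i) ≃ₗ[k] k)) ∧
    ∀ i j, i ≠ j → Subsingleton (StableHom (S i) (S j))

/-- Weakly simple-minded systems. -/
def IsWSMS {ι : Type w} (S : ι → FinMod k R) : Prop :=
  IsOrthogonalSystem S ∧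
    ∀ X : FinMod k R, ¬ StablyZero X → ∃ i, Nontrivial (StableHom X (S i))

/-- Simple-minded systems. -/
def IsSMS {ι : Type w} (S : ι → FinMod k R) : Prop :=
  IsOrthogonalSystem S ∧ ∀ X : FinMod k R, ExtClosure S X

/-- Every object of the stable category has a left `𝒳`-approximation. -/
def CovariantlyFinite (𝒳 : FinMod k R → Prop) : Prop :=
  ∀ M : FinMod k R, ∃ (X : FinMod k R) (f : M →ₗ[R] X), 𝒳 X ∧
    ∀ (X' : FinMod k R) (g : M →ₗ[R] X'), 𝒳 X' → ∃ h : X →ₗ[R] X', StableEq (h ∘ₗ f) g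

/-- Indecomposable modules. -/
def Indec (X : FinMod k R) : Prop :=
  Nontrivial X ∧ ∀ e : Module.End R X, e * e = e → e = 0 ∨ e = 1

/-- `0 → A → E → B → 0` is an almost split sequence. -/
def AlmostSplit {A E B : FinMod k R} (f : A →ₗ[R] E) (g : E →ₗ[R] B) : Prop :=
  Indec A ∧ Indec B ∧ ShortExact f g ∧
    (¬ ∃ s : B →ₗ[R] E, g ∘ₗ s = LinearMap.id) ∧
    (∀ (X : FinMod k R) (h : X →ₗ[R] B),
      (¬ ∃ s : B →ₗ[R] X, h ∘ₗ s = LinearMap.id) → ∃ l : X →ₗ[R] E, g ∘ₗ l = h) ∧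
    (∀ (X : FinMod k R) (h : A →ₗ[R] X),
      (¬ ∃ r : X →ₗ[R] A, r ∘ₗ h = LinearMap.id) → ∃ l : E →ₗ[R] X, l ∘ₗ f = h)

/-- The modules `T 0, T 1, T 2, …` are the vertices, without repetition, of a homogeneous tube,
i.e. of a component of the Auslander–Reiten quiver of the form `ℤA_∞/⟨τ⟩`, where `T 0` is the module
at the mouth: all almost split sequences are
`0 → T 0 → T 1 → T 0 → 0` and `0 → T (n+1) → T n ⊕ T (n+2) → T (n+1) → 0`. -/
def IsHomogeneousTube (T : ℕ → FinMod k R) : Prop :=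
  (∀ n, Indec (T n)) ∧
  (∀ m n, Nonempty (T m ≃ₗ[R] T n) → m = n) ∧
  (∃ (f : T 0 →ₗ[R] T 1) (g : T 1 →ₗ[R] T 0), AlmostSplit f g) ∧
  ∀ n, ∃ (f : T (n + 1) →ₗ[R] (T n).prod (T (n + 2))) (g : (T n).prod (T (n + 2)) →ₗ[R] T (n + 1)),
    AlmostSplit f g

/-- As an object of the stable category, `X` belongs to some homogeneous tube. -/
def InHomogeneousTube (X : FinMod k R) : Prop :=
  ∃ T : ℕ → FinMod k R, IsHomogeneousTube T ∧ ∃ n, StableIso X (T n)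

end FinMod

/-- Every finitely generated left ideal is finitely presented. -/
def IsLeftCoherent (A : Type u) [Ring A] : Prop :=
  ∀ I : Ideal A, I.FG → Module.FinitePresentation A I

/-- Right coherence of the endomorphism ring of a left `R`-module `M` whose endomorphisms are
written on the right, `fg = g ∘ f`. That ring is the opposite of Mathlib's `Module.End R M`, so its
right ideals are the left ideals of `Module.End R M`. -/
def EndRightCoherent (R : Type u) (M : Type v) [Ring R] [AddCommGroup M] [Module R M] : Prop :=
  IsLeftCoherent (Module.End R M)

/-- `M` is finitely generated over its endomorphism ring. -/
def IsFinendo (R : Type u) (M : Type v) [Ring R] [AddCommGroup M] [Module R M] : Prop :=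
  Module.Finite (Module.End R M) M

/-! Part 1: left approximations already exist in the category of modules. Since `R` lies in F(𝒮, R),
it is up to isomorphism a summand of M, so M embeds in End M as an End M-module. A finite
presentation of Y displays Hom(Y, M) as the common kernel of finitely many maps from a power of M to
End M. Finendo and coherence make it finitely generated over End M (`finite_linearMap_end`). The
generators factor jointly through one module X in F(𝒮, R), and Y → X is the approximation.

Part 2: let f : Y → X be a left minimal approximation. As F(𝒮, R) is closed under extensions,
Wakamatsu's argument (`IsLeftApprox.exists_extension`) applies: for a projective P mapping onto X,
maps from the preimage K of im f to members of F(𝒮, R) extend to P. So all maps K → S i are stably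
zero, and weak simple-mindedness makes K projective. Then K is itself a member and splits off P, and
minimality makes f surjective. A pushout shows that every map from ker f to a member is zero, so ker
f is projective, hence a member, and its identity is zero. Thus f is an isomorphism. -/

namespace FinMod

variable {k : Type v} {R : Type u} [Field k] [Ring R] [Algebra k R]

/-! ### Stable isomorphism and projective summands -/

variable (k) in
/-- A finitely generated `R`-module, with the `k`-structure induced by `k → R`. -/
def of (X : Type u) [AddCommGroup X] [Module R X] [Module.Finite R X] : FinMod k R :=
  letI : Module k X := Module.compHom X (algebraMap k R)
  { carrier := X
    tower := ⟨fun c r x => by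
      rw [Algebra.smul_def, mul_smul]
      rfl⟩ }

theorem FactorsProj.comp {X Y Z W : FinMod k R} {f : X →ₗ[R] Y} (hf : FactorsProj f)
    (g : Y →ₗ[R] Z) (h : W →ₗ[R] X) : FactorsProj (g ∘ₗ f ∘ₗ h) := by
  obtain ⟨P, _, _, _, a, b, rfl⟩ := hf
  exact ⟨P, inferInstance, inferInstance, inferInstance, a ∘ₗ h, g ∘ₗ b, rfl⟩

theorem StableEq.refl {X Y : FinMod k R} (f : X →ₗ[R] Y) : StableEq f f := by
  simp [StableEq]

theorem StableEq.trans {X Y : FinMod k R} {f g h : X →ₗ[R] Y} (hf : StableEq f g)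
    (hg : StableEq g h) : StableEq f h := by
  have := add_mem hf hg
  rwa [sub_add_sub_cancel] at this

theorem StableEq.comp_left {X Y Z : FinMod k R} {f g : X →ₗ[R] Y} (h : StableEq f g)
    (a : Y →ₗ[R] Z) : StableEq (a ∘ₗ f) (a ∘ₗ g) := by
  have := FactorsProj.comp h a LinearMap.id
  rwa [LinearMap.comp_id, LinearMap.comp_sub] at this

theorem StableEq.comp_right {X Y Z : FinMod k R} {f g : X →ₗ[R] Y} (h : StableEq f g)
    (a : Z →ₗ[R] X) : StableEq (f ∘ₗ a) (g ∘ₗ a) := by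
  have := FactorsProj.comp h LinearMap.id a
  rwa [LinearMap.id_comp, LinearMap.sub_comp] at this

theorem StableIso.symm {X Y : FinMod k R} (h : StableIso X Y) : StableIso Y X :=
  let ⟨f, g, h₁, h₂⟩ := h
  ⟨g, f, h₂, h₁⟩

theorem StableIso.trans {X Y Z : FinMod k R} (h : StableIso X Y) (h' : StableIso Y Z) :
    StableIso X Z := by
  obtain ⟨f, g, h₁, h₂⟩ := h
  obtain ⟨f', g', h₁', h₂'⟩ := h'
  exact ⟨f' ∘ₗ f, g ∘ₗ g', ((h₁'.comp_right f).comp_left g).trans h₁,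
    ((h₂.comp_right g').comp_left f').trans h₂'⟩

theorem StableIso.of_equiv {X Y : FinMod k R} (e : X ≃ₗ[R] Y) : StableIso X Y := by
  refine ⟨e, e.symm, ?_, ?_⟩
  · rw [LinearEquiv.comp_coe, LinearEquiv.self_trans_symm]
    exact StableEq.refl _
  · rw [LinearEquiv.comp_coe, LinearEquiv.symm_trans_self]
    exact StableEq.refl _

theorem StableIso.refl (X : FinMod k R) : StableIso X X := .of_equiv (.refl R X)

theorem stablyZero_iff {X : FinMod k R} : StablyZero X ↔ Module.Projective R X := by
  constructor
  · rintro ⟨P, _, _, _, a, b, h⟩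
    exact Module.Projective.of_split a b h
  · intro h
    exact ⟨X, inferInstance, inferInstance, h, LinearMap.id, LinearMap.id, rfl⟩

theorem StableIso.prod_projective (X Q : FinMod k R) [Module.Projective R Q] :
    StableIso X (X.prod Q) := by
  refine ⟨LinearMap.inl R X Q, LinearMap.fst R X Q, ?_, ?_⟩
  · exact StableEq.refl (LinearMap.id : X →ₗ[R] X)
  · refine ⟨Q, inferInstance, inferInstance, inferInstance, -LinearMap.snd R X Q,
      LinearMap.inr R X Q, ?_⟩
    refine LinearMap.ext fun x => Prod.ext ?_ ?_
    · change (0 : X) = x.1 - x.1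
      simp
    · change -x.2 = 0 - x.2
      simp

theorem StablyZero.of_stableIso {X Y : FinMod k R} (hX : StablyZero X) (h : StableIso X Y) :
    StablyZero Y := by
  obtain ⟨f, g, -, h₂⟩ := h
  have := sub_mem (show FactorsProj (f ∘ₗ LinearMap.id ∘ₗ g) from FactorsProj.comp hX f g :
    f ∘ₗ LinearMap.id ∘ₗ g ∈ projMaps Y Y) h₂
  rwa [LinearMap.id_comp, sub_sub_cancel] at this

variable (k) in
/-- A finitely generated projective module mapping onto `X`. -/
theorem exists_projective_cover (X : FinMod k R) :
    ∃ (P : FinMod k R) (p : P →ₗ[R] X), Module.Projective R P ∧ Function.Surjective p := by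
  obtain ⟨n, p, hp⟩ := Module.Finite.exists_fin' R X
  exact ⟨of k (Fin n → R), p, inferInstanceAs (Module.Projective R (Fin n → R)), hp⟩

/-- A surjection that has a section splits off its kernel. -/
noncomputable def equivProdKer {A B : Type*} [AddCommGroup A] [Module R A] [AddCommGroup B]
    [Module R B] (f : A →ₗ[R] B) (s : B →ₗ[R] A) (h : f ∘ₗ s = LinearMap.id) :
    A ≃ₗ[R] B × LinearMap.ker f where
  toFun a := (f a, ⟨a - s (f a), by
    have := LinearMap.congr_fun h (f a)
    simp only [LinearMap.comp_apply, LinearMap.id_apply] at this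
    simp [this]⟩)
  map_add' a b := by
    ext <;> simp
    abel
  map_smul' r a := by
    ext <;> simp [smul_sub]
  invFun x := s x.1 + x.2
  left_inv a := by simp
  right_inv x := by
    have := LinearMap.congr_fun h x.1
    simp only [LinearMap.comp_apply, LinearMap.id_apply] at this
    ext <;> simp [this]

variable [IsNoetherianRing R]

/-- Stably isomorphic modules become isomorphic after adding projective modules. -/
theorem StableIso.exists_equiv {X Y : FinMod k R} (h : StableIso X Y) :
    ∃ P Q : FinMod k R, Module.Projective R P ∧ Module.Projective R Q ∧
      Nonempty ((X.prod P) ≃ₗ[R] (Y.prod Q)) := by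
  obtain ⟨f, g, ⟨Q, _, _, _, a', b', h₁⟩, ⟨Q', _, _, _, a, b, h₂⟩⟩ := h
  obtain ⟨P, p, hP, hp⟩ := exists_projective_cover k Y
  obtain ⟨c, hc⟩ := Module.projective_lifting_property p b hp
  -- Here f g - 1 = b a, and c lifts b along p, so the correction -c a turns g into an honest
  -- section of (f, p).
  set F : (X × P) →ₗ[R] Y := f.coprod p with hF
  set s : Y →ₗ[R] (X × P) := g.prod (-(c ∘ₗ a)) with hs
  have hFs : F ∘ₗ s = LinearMap.id := by
    refine LinearMap.ext fun y => ?_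
    have e₁ := LinearMap.congr_fun h₂ y
    have e₂ := LinearMap.congr_fun hc (a y)
    simp only [LinearMap.comp_apply, LinearMap.sub_apply, LinearMap.id_apply] at e₁ e₂
    simp [hF, hs, e₂, e₁]
  -- On the kernel p z₂ = -f z₁, and g f - 1 = b' a', so the inclusion into X × P factors through Q
  -- × P; composing with the projection to the kernel makes it a retract of Q × P.
  have hK : Module.Projective R (LinearMap.ker F) := by
    let u : LinearMap.ker F →ₗ[R] Q × P :=
      ((a' ∘ₗ LinearMap.fst R X P).prod (LinearMap.snd R X P)) ∘ₗ (LinearMap.ker F).subtype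
    let v : Q × P →ₗ[R] X × P :=
      ((-b').coprod (-(g ∘ₗ p))).prod (LinearMap.snd R Q P)
    have huv : v ∘ₗ u = (LinearMap.ker F).subtype := by
      refine LinearMap.ext fun z => ?_
      have hz : f z.1.1 + p z.1.2 = 0 := LinearMap.mem_ker.1 z.2
      have e₁ := LinearMap.congr_fun h₁ z.1.1
      simp only [LinearMap.comp_apply, LinearMap.sub_apply, LinearMap.id_apply] at e₁
      have hp' : p z.1.2 = - f z.1.1 := by rw [eq_neg_iff_add_eq_zero, add_comm, hz]
      refine Prod.ext ?_ rfl
      change -b' (a' z.1.1) + -g (p z.1.2) = z.1.1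
      simp [e₁, hp']
    refine Module.Projective.of_split u
      (LinearMap.snd R Y _ ∘ₗ (equivProdKer F s hFs).toLinearMap ∘ₗ v) ?_
    rw [LinearMap.comp_assoc, LinearMap.comp_assoc, huv]
    ext z
    all_goals simp [equivProdKer]
  exact ⟨P, of k (LinearMap.ker F), hP, hK, ⟨equivProdKer F s hFs⟩⟩

end FinMod

/-! ### Closure of F(𝒮, R) under summands and extensions -/

namespace FinMod

variable {k : Type v} {R : Type u} [Field k] [Ring R] [Algebra k R]

theorem Star.congr {A B : FinMod k R → Prop} {X Y : FinMod k R} (h : Star A B X)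
    (e : StableIso X Y) : Star A B Y := by
  obtain ⟨A₀, B₀, A', X', B', f, g, hA, hB, hfg, eA, eX, eB⟩ := h
  exact ⟨A₀, B₀, A', X', B', f, g, hA, hB, hfg, eA, eX.trans e, eB⟩

variable {ι : Type w} {S : ι → FinMod k R}

theorem stage.congr {n : ℕ} {X Y : FinMod k R} (h : stage S n X) (e : StableIso X Y) :
    stage S n Y := by
  cases n with
  | zero => exact StablyZero.of_stableIso h e
  | succ n => exact Star.congr h e

theorem ExtClosure.of_stage {n : ℕ} {X : FinMod k R} (h : stage S n X) : ExtClosure S X := by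
  refine ⟨n, of k PUnit, X, h, StableIso.symm ?_⟩
  exact .of_equiv (LinearEquiv.prodUnique (R := R) (M := X) (M₂ := PUnit.{u + 1})).symm

theorem ExtClosure.of_projective (X : FinMod k R) [h : Module.Projective R X] :
    ExtClosure S X :=
  .of_stage (n := 0) (stablyZero_iff.2 h)

theorem extClosure_iff {X : FinMod k R} :
    ExtClosure S X ↔ ∃ (n : ℕ) (Y : FinMod k R), stage S n (X.prod Y) :=
  ⟨fun ⟨n, Y, _, hZ, e⟩ => ⟨n, Y, hZ.congr e.symm⟩, fun ⟨n, Y, h⟩ => ⟨n, Y, _, h, .refl _⟩⟩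

theorem ExtClosure.of_prod {X Y : FinMod k R} (h : ExtClosure S (X.prod Y)) :
    ExtClosure S X := by
  obtain ⟨n, Z, h⟩ := extClosure_iff.1 h
  exact extClosure_iff.2 ⟨n, Y.prod Z, h.congr (.of_equiv (LinearEquiv.prodAssoc R X Y Z))⟩

theorem ExtClosure.congr {X Y : FinMod k R} (h : ExtClosure S X) (e : X ≃ₗ[R] Y) :
    ExtClosure S Y := by
  obtain ⟨n, Z, h⟩ := extClosure_iff.1 h
  exact extClosure_iff.2 ⟨n, Z, h.congr (.of_equiv (e.prodCongr (.refl R Z)))⟩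

theorem IsWSMS.stablyZero (hS : IsWSMS S) {X : FinMod k R}
    (h : ∀ (i : ι) (f : X →ₗ[R] S i), FactorsProj f) : StablyZero X := by
  by_contra hX
  obtain ⟨i, hi⟩ := hS.2 X hX
  obtain ⟨x, hx⟩ := exists_ne (0 : StableHom X (S i))
  obtain ⟨f, rfl⟩ := (projMaps X (S i)).mkQ_surjective x
  exact hx ((Submodule.Quotient.mk_eq_zero _).2 (h i f))

variable [IsNoetherianRing R]

theorem Star.of_surjective {A B : FinMod k R → Prop} {X Z : FinMod k R} (g : X →ₗ[R] Z)
    (hg : Function.Surjective g) (hA : A (of k (LinearMap.ker g))) {Z' : FinMod k R} (hB : B Z')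
    (e : StableIso Z Z') : Star A B X :=
  ⟨_, Z', of k (LinearMap.ker g), X, Z, (LinearMap.ker g).subtype, g, hA, hB,
    ⟨(LinearMap.ker g).injective_subtype, LinearMap.exact_subtype_ker_map g, hg⟩,
    .refl _, .refl _, e⟩

/-- An extension of an object of `(𝒮)ₙ` by an object of `(𝒮)ₘ` lies in `(𝒮)ₘ₊ₙ`. -/
theorem stage.of_surjective {m : ℕ} (n : ℕ) {Y Z : FinMod k R} (g : Y →ₗ[R] Z)
    (hg : Function.Surjective g) (hA : stage S m (of k (LinearMap.ker g))) (hZ : stage S n Z) :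
    stage S (m + n) Y := by
  induction n generalizing Y Z with
  | zero =>
    have : Module.Projective R Z := stablyZero_iff.1 hZ
    obtain ⟨s, hs⟩ := Module.projective_lifting_property g LinearMap.id hg
    refine hA.congr (.trans (.prod_projective _ Z) (.of_equiv ?_))
    exact (LinearEquiv.prodComm R _ _).trans (equivProdKer g s hs).symm
  | succ n ih =>
    obtain ⟨A, B, A', X', B', i, q, hA', hB, ⟨hi, hiq, hq⟩, eA, eX, eB⟩ := hZ
    obtain ⟨P, Q, hP, hQ, ⟨e⟩⟩ := eX.exists_equiv
    let e' : (X' × P) ≃ₗ[R] (Z × Q) := e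
    -- the kernel of `h` is `A' × P`
    let h : (Z × Q) →ₗ[R] B' := (q ∘ₗ LinearMap.fst R X' P) ∘ₗ e'.symm.toLinearMap
    have hh : Function.Surjective h :=
      (hq.comp Prod.fst_surjective).comp e'.symm.surjective
    have eK : StableIso A (of k (LinearMap.ker h)) := by
      refine eA.symm.trans (.trans (.prod_projective A' P) (.of_equiv ?_))
      refine LinearEquiv.ofBijective (M := A' × P) (M₂ := LinearMap.ker h)
        (LinearMap.codRestrict (LinearMap.ker h)
          (e'.toLinearMap ∘ₗ i.prodMap LinearMap.id) fun x => ?_) ⟨?_, ?_⟩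
      · have := hiq.apply_apply_eq_zero x.1
        simpa [h] using this
      · intro x y hxy
        have := e'.injective (congrArg Subtype.val hxy)
        have h₂ : x.2 = y.2 := congrArg (fun t : X' × P => t.2) this
        exact Prod.ext (hi (congrArg Prod.fst this)) h₂
      · rintro ⟨z, hz⟩
        obtain ⟨a, ha⟩ := (hiq _).1 (LinearMap.mem_ker.1 hz)
        refine ⟨(a, (e'.symm z).2), Subtype.ext ?_⟩
        change e' (i a, (e'.symm z).2) = z
        rw [ha]
        exact e'.apply_symm_apply z
    -- Y × Q is stably Y and maps onto B'. The kernel of this map is an extension of ker h, which is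
    -- in stage n, by ker g, so induction applies to it.
    let g' : (Y × Q) →ₗ[R] (Z × Q) := g.prodMap LinearMap.id
    have hg' : Function.Surjective g' := hg.prodMap Function.surjective_id
    let G : (Y.prod Q) →ₗ[R] B' := h ∘ₗ g'
    let r : LinearMap.ker G →ₗ[R] LinearMap.ker h :=
      LinearMap.restrict (p := LinearMap.ker G) (q := LinearMap.ker h) g' fun x hx => hx
    have hr : Function.Surjective r := by
      rintro ⟨z, hz⟩
      obtain ⟨y, rfl⟩ := hg' z
      exact ⟨⟨y, hz⟩, rfl⟩
    have eR : LinearMap.ker g ≃ₗ[R] LinearMap.ker r := by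
      have h0 (x : LinearMap.ker g) : g' (x.1, 0) = 0 := Prod.ext x.2 rfl
      refine LinearEquiv.ofBijective (LinearMap.codRestrict (LinearMap.ker r)
        (LinearMap.codRestrict (LinearMap.ker G)
          (LinearMap.inl R Y Q ∘ₗ (LinearMap.ker g).subtype) fun x => ?_) fun x => ?_) ⟨?_, ?_⟩
      · change h (g' (x.1, 0)) = 0
        rw [h0, map_zero]
      · exact Subtype.ext (h0 x)
      · intro x y hxy
        exact Subtype.ext (congrArg (fun t => t.1.1.1) hxy)
      · rintro ⟨⟨⟨y, z⟩, h1⟩, h2⟩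
        have h3 : (g y, z) = (0 : Z × Q) := congrArg Subtype.val h2
        refine ⟨⟨y, congrArg Prod.fst h3⟩, Subtype.ext (Subtype.ext (Prod.ext rfl ?_))⟩
        exact (congrArg Prod.snd h3).symm
    have hK : stage S (m + n) (of k (LinearMap.ker G)) :=
      ih (Y := of k (LinearMap.ker G)) (Z := of k (LinearMap.ker h)) r hr
        (hA.congr (.of_equiv eR)) (hA'.congr eK)
    have hX : stage S (m + (n + 1)) (Y.prod Q) :=
      Star.of_surjective G (hh.comp hg') hK hB eB
    exact hX.congr (StableIso.prod_projective Y Q).symm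

/-- `F(𝒮, R)` is closed under extensions. -/
theorem ExtClosure.of_surjective {Y Z : FinMod k R} (g : Y →ₗ[R] Z)
    (hg : Function.Surjective g) (hA : ExtClosure S (of k (LinearMap.ker g)))
    (hZ : ExtClosure S Z) : ExtClosure S Y := by
  obtain ⟨m, A', hA⟩ := extClosure_iff.1 hA
  obtain ⟨n, Z', hZ⟩ := extClosure_iff.1 hZ
  -- Adding the complements A' and Z' puts both ends in stages: the quotient is Z × Z' and the
  -- kernel is ker g × A'.
  let G : (Y × (A' × Z')) →ₗ[R] (Z × Z') := g.prodMap (LinearMap.snd R A' Z')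
  have hG : Function.Surjective G := hg.prodMap Prod.snd_surjective
  refine extClosure_iff.2 ⟨m + n, A'.prod Z', ?_⟩
  refine stage.of_surjective (Y := Y.prod (A'.prod Z')) (Z := Z.prod Z') n G hG
    (hA.congr (.of_equiv ?_)) hZ
  refine LinearEquiv.ofBijective (M := LinearMap.ker g × A') (M₂ := LinearMap.ker G)
    (LinearMap.codRestrict (LinearMap.ker G)
      ((LinearMap.ker g).subtype.prodMap (LinearMap.inl R A' Z')) fun x => ?_) ⟨?_, ?_⟩
  · exact Prod.ext x.1.2 rfl
  · intro x y hxy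
    have := congrArg Subtype.val hxy
    exact Prod.ext (Subtype.ext (congrArg Prod.fst this)) (congrArg (fun t => t.2.1) this)
  · rintro ⟨⟨y, a, z⟩, hx⟩
    have h3 : (g y, z) = (0 : Z × Z') := hx
    refine ⟨(⟨y, congrArg Prod.fst h3⟩, a), Subtype.ext (Prod.ext rfl (Prod.ext rfl ?_))⟩
    exact (congrArg Prod.snd h3).symm

theorem ExtClosure.prod {X Y : FinMod k R} (hX : ExtClosure S X) (hY : ExtClosure S Y) :
    ExtClosure S (X.prod Y) := by
  refine ExtClosure.of_surjective (Y := X.prod Y) (LinearMap.snd R X Y) Prod.snd_surjective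
    (hX.congr ?_) hY
  refine LinearEquiv.ofBijective (M₂ := LinearMap.ker (LinearMap.snd R X Y))
    (LinearMap.codRestrict _ (LinearMap.inl R X Y) fun x => ?_) ⟨?_, ?_⟩
  · rfl
  · intro x y hxy
    exact congrArg (fun t => t.1.1) hxy
  · rintro ⟨⟨x, y⟩, h⟩
    exact ⟨x, Subtype.ext (Prod.ext rfl (show 0 = y from Eq.symm h))⟩

theorem ExtClosure.of_member (i : ι) : ExtClosure S (S i) := by
  refine .of_stage (n := 1) ?_
  let z : S i →ₗ[R] S i := LinearMap.id
  refine Star.of_surjective z Function.surjective_id (stablyZero_iff.2 ?_) (.inl ⟨i, rfl⟩)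
    (.refl _)
  have : Subsingleton (LinearMap.ker z) := by
    rw [show LinearMap.ker z = ⊥ from LinearMap.ker_id]
    infer_instance
  exact inferInstanceAs (Module.Projective R (LinearMap.ker z))

end FinMod

/-! ### Coherence and finite generation of Hom(Y, M) -/

/-- A linear map that vanishes on the kernel of a surjection descends along it. -/
theorem LinearMap.exists_comp_eq_of_ker_le {R A B C : Type*} [Ring R] [AddCommGroup A] [Module R A]
    [AddCommGroup B] [Module R B] [AddCommGroup C] [Module R C] (p : A →ₗ[R] B)
    (hp : Function.Surjective p) (l : A →ₗ[R] C) (h : LinearMap.ker p ≤ LinearMap.ker l) :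
    ∃ l' : B →ₗ[R] C, l' ∘ₗ p = l := by
  refine ⟨(LinearMap.ker p).liftQ l h ∘ₗ (p.quotKerEquivOfSurjective hp).symm, ?_⟩
  refine LinearMap.ext fun y => ?_
  change (LinearMap.ker p).liftQ l h ((p.quotKerEquivOfSurjective hp).symm (p y)) = l y
  rw [show (p.quotKerEquivOfSurjective hp).symm (p y) = (LinearMap.ker p).mkQ y from
    (LinearEquiv.symm_apply_eq _).2 rfl]
  simp

/-- Over a left coherent ring, finitely many functionals on a finitely generated module have a
finitely generated common kernel. -/
theorem IsLeftCoherent.fg_iInf_ker {A : Type u} [Ring A] (hA : IsLeftCoherent A) {M : Type v}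
    [AddCommGroup M] [Module A M] [Module.Finite A M] {α : Type w} (φ : α → M →ₗ[A] A)
    (t : Finset α) : (⨅ i ∈ t, LinearMap.ker (φ i)).FG := by
  classical
  induction t using Finset.induction_on with
  | empty => simpa using Module.Finite.fg_top
  | insert i t _ ih =>
    rw [Finset.iInf_insert]
    set N := ⨅ i ∈ t, LinearMap.ker (φ i)
    have : Module.Finite A N := Module.Finite.of_fg ih
    -- The image of ψ is a finitely generated left ideal, hence finitely presented, so ker ψ is
    -- finitely generated.
    let ψ := (φ i).domRestrict N
    have hψ : Module.FinitePresentation A (LinearMap.range ψ) :=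
      hA _ (by
        rw [LinearMap.range_eq_map]
        exact Submodule.FG.map ψ Module.Finite.fg_top)
    have := Module.FinitePresentation.fg_ker ψ.rangeRestrict ψ.surjective_rangeRestrict
    rw [LinearMap.ker_rangeRestrict] at this
    have := this.map N.subtype
    rwa [show (LinearMap.ker ψ).map N.subtype = LinearMap.ker (φ i) ⊓ N from ?_] at this
    ext m
    simp [ψ, and_comm]

/-- If the `R`-module `M` has finitely generated `End M`-module structure, embeds in its left
coherent endomorphism ring, and `Y` is finitely presented, then `Hom(Y, M)` is finitely generated
over `End M`. -/
theorem finite_linearMap_end {R : Type u} [Ring R] {M : Type v} [AddCommGroup M] [Module R M]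
    (hcoh : EndRightCoherent R M) (hfin : IsFinendo R M)
    (j : M →ₗ[Module.End R M] Module.End R M) (hj : Function.Injective j)
    (Y : Type w) [AddCommGroup Y] [Module R Y] [Module.FinitePresentation R Y] :
    Module.Finite (Module.End R M) (Y →ₗ[R] M) := by
  have : Module.Finite (Module.End R M) M := hfin
  obtain ⟨n, q, hq⟩ := Module.Finite.exists_fin' R Y
  obtain ⟨t, ht⟩ := Module.FinitePresentation.fg_ker q hq
  have : Module.Finite (Module.End R M) ((Fin n → R) →ₗ[R] M) :=
    Module.Finite.equiv ((Pi.basisFun R (Fin n)).constr (Module.End R M) (M' := M))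
  let φ (y : Fin n → R) : ((Fin n → R) →ₗ[R] M) →ₗ[Module.End R M] Module.End R M :=
    j ∘ₗ LinearMap.applyₗ' (Module.End R M) y
  have hfg := IsLeftCoherent.fg_iInf_ker hcoh φ t
  let c : (Y →ₗ[R] M) →ₗ[Module.End R M] ((Fin n → R) →ₗ[R] M) :=
    LinearMap.lcomp (Module.End R M) M q
  have hc : Function.Injective c := fun f g h => (LinearMap.cancel_right hq).1 h
  have hr : LinearMap.range c = ⨅ y ∈ t, LinearMap.ker (φ y) := by
    ext a
    simp only [LinearMap.mem_range, Submodule.mem_iInf, LinearMap.mem_ker]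
    constructor
    · rintro ⟨f, rfl⟩ y hy
      have : q y = 0 := by
        rw [← LinearMap.mem_ker, ← ht]
        exact Submodule.subset_span hy
      change j (f (q y)) = 0
      rw [this, map_zero, map_zero]
    · intro h
      have hle : LinearMap.ker q ≤ LinearMap.ker a := by
        rw [← ht, Submodule.span_le]
        intro y hy
        exact hj ((h y hy).trans (map_zero j).symm)
      exact q.exists_comp_eq_of_ker_le hq a hle
  rw [← hr] at hfg
  have : Module.Finite (Module.End R M) (LinearMap.range c) := Module.Finite.of_fg hfg
  exact Module.Finite.equiv (LinearEquiv.ofInjective c hc).symm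

/-! ### Left approximations -/

namespace FinMod

variable {k : Type v} {R : Type u} [Field k] [Ring R] [Algebra k R] [IsNoetherianRing R]
  {ι : Type w} {S : ι → FinMod k R}

theorem exists_approximation_finset {M : Type x} [AddCommGroup M] [Module R M] {Y : FinMod k R}
    (hfac : ∀ g : Y →ₗ[R] M, ∃ X : FinMod k R, ExtClosure S X ∧
      ∃ (a : Y →ₗ[R] X) (b : X →ₗ[R] M), b ∘ₗ a = g) (t : Finset (Y →ₗ[R] M)) :
    ∃ X : FinMod k R, ExtClosure S X ∧ ∃ f : Y →ₗ[R] X, ∀ g ∈ t, ∃ b : X →ₗ[R] M, b ∘ₗ f = g := by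
  classical
  induction t using Finset.induction_on with
  | empty =>
    exact ⟨of k PUnit, .of_projective (h := inferInstanceAs (Module.Projective R PUnit.{u + 1})) _, 0,
      by simp⟩
  | insert g t _ ih =>
    obtain ⟨X, hX, f, hf⟩ := ih
    obtain ⟨X', hX', a, b, rfl⟩ := hfac g
    refine ⟨X.prod X', hX.prod hX', LinearMap.prod f a, fun g' hg' => ?_⟩
    rcases Finset.mem_insert.1 hg' with rfl | hg'
    · exact ⟨b ∘ₗ LinearMap.snd R X X', rfl⟩
    · obtain ⟨b', rfl⟩ := hf g' hg'
      exact ⟨b' ∘ₗ LinearMap.fst R X X', rfl⟩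

/-- A finitely generated module meets only finitely many summands, and their finite product is again
in F(𝒮, R). -/
theorem exists_factor_directSum {J : Type x} {N : J → FinMod k R}
    (hN : ∀ j, ExtClosure S (N j)) (Y : FinMod k R)
    (g : Y →ₗ[R] DirectSum J (fun j => (N j).carrier)) :
    ∃ X : FinMod k R, ExtClosure S X ∧ ∃ (a : Y →ₗ[R] X)
      (b : X →ₗ[R] DirectSum J (fun j => (N j).carrier)), b ∘ₗ a = g := by
  classical
  obtain ⟨t, ht⟩ := Module.Finite.fg_top (R := R) (M := Y)
  obtain ⟨s, hs⟩ : ∃ s : Finset J, s = t.biUnion fun y => DFinsupp.support (g y) := ⟨_, rfl⟩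
  let e (j : J) : DirectSum J (fun j => (N j).carrier) →ₗ[R]
    DirectSum J (fun j => (N j).carrier) := DirectSum.lof R J _ j ∘ₗ DirectSum.component R J _ j
  have hg : g = ∑ j ∈ s, e j ∘ₗ g := by
    refine LinearMap.ext_on (s := t) ht fun y hy => ?_
    refine DFinsupp.ext fun i => ?_
    rw [LinearMap.sum_apply]
    change _ = DirectSum.component R J _ i (∑ j ∈ s, e j (g y))
    rw [map_sum]
    by_cases hi : i ∈ s
    · rw [Finset.sum_eq_single_of_mem i hi]
      · simp [e, DirectSum.component.lof_self]
        rfl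
      · intro j _ hj
        simp [e, DirectSum.component.of, hj]
    · rw [Finset.sum_eq_zero]
      · by_contra h
        exact hi (hs ▸ Finset.mem_biUnion.2 ⟨y, hy, DFinsupp.mem_support_iff.2 h⟩)
      · intro j hj
        have : j ≠ i := fun h => hi (h ▸ hj)
        simp [e, DirectSum.component.of, this]
  rw [hg]
  clear hg hs
  induction s using Finset.induction_on with
  | empty =>
    exact ⟨of k PUnit, .of_projective (h := inferInstanceAs (Module.Projective R PUnit.{u + 1})) _, 0, 0,
      by simp⟩
  | insert j s hj ih =>
    obtain ⟨X, hX, a, b, hab⟩ := ih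
    refine ⟨(N j).prod X, (hN j).prod hX, (DirectSum.component R J _ j ∘ₗ g).prod a,
      (DirectSum.lof R J (fun j => (N j).carrier) j).coprod b, ?_⟩
    rw [Finset.sum_insert hj, ← hab]
    rfl

/-- Left approximations in the category of modules. -/
theorem exists_approximation {J : Type x} {N : J → FinMod k R}
    (hN : ∀ j, ExtClosure S (N j))
    (hN' : ∀ X : FinMod k R, ExtClosure S X → ∃ j, Nonempty (X ≃ₗ[R] N j))
    (hcoh : EndRightCoherent R (DirectSum J (fun j => (N j).carrier)))
    (hfin : IsFinendo R (DirectSum J (fun j => (N j).carrier))) (Y : FinMod k R) :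
    ∃ X : FinMod k R, ExtClosure S X ∧ ∃ f : Y →ₗ[R] X, ∀ (X' : FinMod k R) (g : Y →ₗ[R] X'),
      ExtClosure S X' → ∃ h : X →ₗ[R] X', h ∘ₗ f = g := by
  classical
  set M := DirectSum J (fun j => (N j).carrier) with hM
  obtain ⟨j₀, ⟨e₀⟩⟩ := hN' (of k R)
    (.of_projective (h := inferInstanceAs (Module.Projective R R)) _)
  let e : R ≃ₗ[R] N j₀ := e₀
  let π : M →ₗ[R] R := e.symm.toLinearMap ∘ₗ DirectSum.component R J _ j₀
  -- m goes to x ↦ π(x) m, which is injective because π takes the value 1.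
  let j : M →ₗ[Module.End R M] Module.End R M :=
    { toFun := fun m => LinearMap.toSpanSingleton R M m ∘ₗ π
      map_add' := fun m m' => by
        refine LinearMap.ext fun x => ?_
        exact smul_add (π x) m m'
      map_smul' := fun c m => by
        refine LinearMap.ext fun x => ?_
        exact (c.map_smul (π x) m).symm }
  have hj : Function.Injective j := by
    intro m m' h
    have h₁ : π (DirectSum.lof R J (fun j => (N j).carrier) j₀ (e 1)) = 1 := by
      change e.symm (DirectSum.component R J (fun j => (N j).carrier) j₀ _) = 1
      rw [DirectSum.component.lof_self]
      exact e.symm_apply_apply 1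
    have : π (DirectSum.lof R J (fun j => (N j).carrier) j₀ (e 1)) • m =
      π (DirectSum.lof R J (fun j => (N j).carrier) j₀ (e 1)) • m' := LinearMap.congr_fun h _
    rwa [h₁, one_smul, one_smul] at this
  have : Module.FinitePresentation R Y := Module.finitePresentation_of_finite R Y
  have hF := finite_linearMap_end hcoh hfin j hj Y
  obtain ⟨t, ht⟩ := Module.Finite.fg_top (R := Module.End R M) (M := Y →ₗ[R] M)
  obtain ⟨X, hX, f, hf⟩ := exists_approximation_finset (exists_factor_directSum hN Y) t
  -- The maps that factor through f form an End M-submodule, so generators suffice.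
  have hall (g : Y →ₗ[R] M) : ∃ b : X →ₗ[R] M, b ∘ₗ f = g := by
    have hg : g ∈ Submodule.span (Module.End R M) (t : Set (Y →ₗ[R] M)) := by
      rw [ht]
      trivial
    induction hg using Submodule.span_induction with
    | mem g hg => exact hf g hg
    | zero => exact ⟨0, by simp⟩
    | add g g' _ _ h h' =>
      obtain ⟨b, rfl⟩ := h
      obtain ⟨b', rfl⟩ := h'
      exact ⟨b + b', rfl⟩
    | smul c g _ h =>
      obtain ⟨b, rfl⟩ := h
      exact ⟨c ∘ₗ b, rfl⟩
  refine ⟨X, hX, f, fun X' g hX' => ?_⟩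
  obtain ⟨i, ⟨a⟩⟩ := hN' X' hX'
  obtain ⟨b, hb⟩ := hall (DirectSum.lof R J (fun j => (N j).carrier) i ∘ₗ a.toLinearMap ∘ₗ g)
  refine ⟨a.symm.toLinearMap ∘ₗ DirectSum.component R J _ i ∘ₗ b, LinearMap.ext fun y => ?_⟩
  have := LinearMap.congr_fun hb y
  simp only [LinearMap.comp_apply] at this ⊢
  rw [this, DirectSum.component.lof_self]
  exact a.symm_apply_apply _

end FinMod

/-! ### Minimal approximations and Wakamatsu's lemma -/

namespace FinMod

variable {k : Type v} {R : Type u} [Field k] [Ring R] [Algebra k R] [IsNoetherianRing R]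
  {ι : Type w} {S : ι → FinMod k R}

/-- The pushout of the short exact sequence given by a surjection `p : P → X` along a map
`g : ker p → Z`. -/
theorem exists_pushout {P X Z : FinMod k R} (hX : ExtClosure S X) (hZ : ExtClosure S Z)
    (p : P →ₗ[R] X) (hp : Function.Surjective p) (g : LinearMap.ker p →ₗ[R] Z) :
    ∃ V : FinMod k R, ExtClosure S V ∧ ∃ (a : Z →ₗ[R] V) (b : P →ₗ[R] V) (π : V →ₗ[R] X),
      Function.Injective a ∧ LinearMap.range a = LinearMap.ker π ∧ π ∘ₗ b = p ∧
        ∀ q : LinearMap.ker p, b q = a (g q) := by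
  let r : LinearMap.ker p →ₗ[R] Z × P := (-g).prod (LinearMap.ker p).subtype
  let V := (Z × P) ⧸ LinearMap.range r
  let a : Z →ₗ[R] V := (LinearMap.range r).mkQ ∘ₗ LinearMap.inl R Z P
  let b : P →ₗ[R] V := (LinearMap.range r).mkQ ∘ₗ LinearMap.inr R Z P
  let π : V →ₗ[R] X := (LinearMap.range r).liftQ (p ∘ₗ LinearMap.snd R Z P) <| by
    rintro _ ⟨q, rfl⟩
    exact q.2
  have ha : Function.Injective a := by
    rw [injective_iff_map_eq_zero]
    intro z hz
    obtain ⟨q, hq⟩ := (Submodule.Quotient.mk_eq_zero _).1 hz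
    have h₁ : -g q = z := congrArg Prod.fst hq
    have h₂ : q = 0 := Subtype.ext (congrArg Prod.snd hq)
    rw [← h₁, h₂, map_zero, neg_zero]
  have hb (q : LinearMap.ker p) : b q = a (g q) := by
    refine (Submodule.Quotient.eq _).2 ⟨q, ?_⟩
    simp [r]
  have hr : LinearMap.range a = LinearMap.ker π := by
    apply le_antisymm
    · rintro _ ⟨z, rfl⟩
      exact map_zero p
    · intro v hv
      obtain ⟨⟨z, y⟩, rfl⟩ := (LinearMap.range r).mkQ_surjective v
      have hy : p y = 0 := hv
      refine ⟨z + g ⟨y, hy⟩, ?_⟩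
      rw [map_add, ← hb]
      change (LinearMap.range r).mkQ (z, 0) + (LinearMap.range r).mkQ (0, y) = _
      rw [← map_add]
      simp
  have hπ : Function.Surjective π := fun x => by
    obtain ⟨y, rfl⟩ := hp x
    exact ⟨b y, rfl⟩
  refine ⟨of k V, ?_, a, b, π, ha, hr, rfl, hb⟩
  refine ExtClosure.of_surjective (Y := of k V) π hπ (hZ.congr ?_) hX
  exact (LinearEquiv.ofInjective a ha).trans (LinearEquiv.ofEq _ _ hr)

/-- `f` is a left `F(𝒮, R)`-approximation. -/
def IsLeftApprox (S : ι → FinMod k R) {Y X : FinMod k R} (f : Y →ₗ[R] X) : Prop :=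
  ExtClosure S X ∧ ∀ (X' : FinMod k R) (g : Y →ₗ[R] X'), ExtClosure S X' →
    ∃ h : X →ₗ[R] X', h ∘ₗ f = g

/-- If there is a left approximation then there is a left minimal one. -/
theorem exists_minimal_approx [IsArtinianRing R] {Y : FinMod k R}
    (hY : ∃ (X : FinMod k R) (f : Y →ₗ[R] X), IsLeftApprox S f) :
    ∃ (X : FinMod k R) (f : Y →ₗ[R] X), IsLeftApprox S f ∧
      ∀ h : X →ₗ[R] X, h ∘ₗ f = f → Function.Bijective h := by
  obtain ⟨_, ⟨X, f, hf, rfl⟩, hmin⟩ := wellFounded_lt.has_min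
    {l : ℕ∞ | ∃ (X : FinMod k R) (f : Y →ₗ[R] X), IsLeftApprox S f ∧ Module.length R X = l}
    (let ⟨X, f, h⟩ := hY; ⟨_, X, f, h, rfl⟩)
  refine ⟨X, f, hf, fun h hh => ?_⟩
  -- Fitting: X is the direct sum of ker hⁿ and im hⁿ. Since h fixes f, im hⁿ also carries an
  -- approximation, so least length forces im hⁿ = X; n ≥ 1 then gives surjectivity of h.
  obtain ⟨n, hc, hn⟩ := (h.eventually_isCompl_ker_pow_range_pow.and
    (Filter.eventually_ge_atTop 1)).exists
  have hfix (m : ℕ) (y : Y) : (h ^ m) (f y) = f y := by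
    induction m with
    | zero => rfl
    | succ m ih =>
      rw [pow_succ, Module.End.mul_apply, show h (f y) = f y from LinearMap.congr_fun hh y, ih]
  have hrange : LinearMap.range (h ^ n) = ⊤ := by
    by_contra hne
    refine hmin _ ?_ (Submodule.length_lt hne)
    refine ⟨of k (LinearMap.range (h ^ n)),
      f.codRestrict (LinearMap.range (h ^ n)) fun y => ⟨f y, hfix n y⟩, ⟨?_, ?_⟩, rfl⟩
    · refine ExtClosure.of_prod (Y := of k (LinearMap.ker (h ^ n))) (hf.1.congr ?_)
      exact (Submodule.prodEquivOfIsCompl _ _ hc.symm).symm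
    · intro X' g hX'
      obtain ⟨u, rfl⟩ := hf.2 X' g hX'
      exact ⟨u ∘ₗ (LinearMap.range (h ^ n)).subtype, rfl⟩
  have hsurj : Function.Surjective h := by
    obtain ⟨m, rfl⟩ := Nat.exists_eq_add_of_le' hn
    rw [LinearMap.range_eq_top, pow_succ', Module.End.coe_mul] at hrange
    exact hrange.of_comp
  exact IsNoetherian.bijective_of_surjective_endomorphism h hsurj

/-- A form of Wakamatsu's lemma. -/
theorem IsLeftApprox.exists_extension {X Y P Z : FinMod k R} {f : Y →ₗ[R] X}
    (hf : IsLeftApprox S f) (hmin : ∀ h : X →ₗ[R] X, h ∘ₗ f = f → Function.Bijective h)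
    (p : P →ₗ[R] X) (hp : Function.Surjective p) (hZ : ExtClosure S Z)
    (g : (LinearMap.range f).comap p →ₗ[R] Z) :
    ∃ G : P →ₗ[R] Z, G ∘ₗ ((LinearMap.range f).comap p).subtype = g := by
  let K := (LinearMap.range f).comap p
  have hle : LinearMap.ker p ≤ K := fun q hq => ⟨0, by rw [map_zero, LinearMap.mem_ker.1 hq]⟩
  obtain ⟨V, hV, a, b, π, ha, hr, hπb, hb⟩ :=
    exists_pushout hf.1 hZ p hp (g ∘ₗ Submodule.inclusion hle)
  have hπa (z : Z) : π (a z) = 0 := by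
    rw [← LinearMap.mem_ker, ← hr]
    exact ⟨z, rfl⟩
  have hπb' (q : P) : π (b q) = p q := LinearMap.congr_fun hπb q
  -- `K → V` descends to the range of `f`
  let p' : K →ₗ[R] LinearMap.range f := p.restrict fun q hq => hq
  have hp' : Function.Surjective p' := by
    rintro ⟨x, hx⟩
    obtain ⟨q, rfl⟩ := hp x
    exact ⟨⟨q, hx⟩, rfl⟩
  -- On ker p the maps b and a g agree, so b - a g induces l on im f, a partial section of π.
  obtain ⟨l, hl⟩ := p'.exists_comp_eq_of_ker_le hp' (b ∘ₗ K.subtype - a ∘ₗ g) <| by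
    intro q hq
    have hq' : p q = 0 := congrArg Subtype.val hq
    have := hb ⟨q, hq'⟩
    change b q - a (g q) = 0
    rw [sub_eq_zero]
    exact this
  have hl' (q : K) : l (p' q) = b q - a (g q) := LinearMap.congr_fun hl q
  obtain ⟨u, hu⟩ := hf.2 V (l ∘ₗ f.rangeRestrict) hV
  have hu' (y : Y) : u (f y) = l (f.rangeRestrict y) := LinearMap.congr_fun hu y
  have hfix (y : Y) : π (u (f y)) = f y := by
    obtain ⟨q, hq⟩ := hp' (f.rangeRestrict y)
    rw [hu', ← hq, hl', map_sub, hπa, sub_zero, hπb']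
    exact congrArg Subtype.val hq
  -- Minimality makes π u invertible; correcting u by its inverse gives a section s of π that still
  -- extends l.
  let e : X ≃ₗ[R] X := LinearEquiv.ofBijective (π ∘ₗ u) (hmin _ (LinearMap.ext hfix))
  let s : X →ₗ[R] V := u ∘ₗ e.symm.toLinearMap
  have hs (x : X) : π (s x) = x := e.apply_symm_apply x
  have hsf (y : Y) : s (f y) = l (f.rangeRestrict y) := by
    have : e.symm (f y) = f y := (LinearEquiv.symm_apply_eq e).2 (hfix y).symm
    change u (e.symm (f y)) = _
    rw [this, hu']
  -- b - s p lands in ker π = im a, and on K it equals b - (b - a g) = a g.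
  let G : P →ₗ[R] Z := (LinearEquiv.ofInjective a ha).symm.toLinearMap ∘ₗ
    (b - s ∘ₗ p).codRestrict (LinearMap.range a) fun q => by
      rw [hr, LinearMap.mem_ker, LinearMap.sub_apply, map_sub, hπb', LinearMap.comp_apply, hs,
        sub_self]
  have hG (q : P) : a (G q) = b q - s (p q) :=
    congrArg Subtype.val ((LinearEquiv.ofInjective a ha).apply_symm_apply _)
  refine ⟨G, LinearMap.ext fun q => ha ?_⟩
  obtain ⟨y, hy⟩ := q.2
  have hq : f.rangeRestrict y = p' q := Subtype.ext hy
  change a (G q) = a (g q)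
  rw [hG, ← hy, hsf, hq, hl', sub_sub_cancel]

/-- A weakly simple-minded system with enough left approximations is simple-minded. -/
theorem IsWSMS.extClosure_of_approx [IsArtinianRing R] (hS : IsWSMS S) {Y : FinMod k R}
    (hY : ∃ (X : FinMod k R) (f : Y →ₗ[R] X), IsLeftApprox S f) : ExtClosure S Y := by
  obtain ⟨X, f, hf, hmin⟩ := exists_minimal_approx hY
  have hsurj : Function.Surjective f := by
    obtain ⟨P, p, hP, hp⟩ := exists_projective_cover k X
    set K := (LinearMap.range f).comap p
    have hK : StablyZero (of k K) := hS.stablyZero fun i g => by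
      obtain ⟨G, hG⟩ := hf.exists_extension hmin p hp (.of_member i) g
      exact ⟨P, inferInstance, inferInstance, hP, K.subtype, G, hG⟩
    obtain ⟨r, hr⟩ := hf.exists_extension hmin p hp (Z := of k K)
      (.of_stage (n := 0) hK) LinearMap.id
    let r' : P →ₗ[R] K := r
    have hr' (q : K) : r' q = q := LinearMap.congr_fun hr q
    -- The retraction of P onto K induces an endomorphism ρ of X with image in im f and ρ f = f;
    -- minimality makes ρ bijective, so im f = X.
    obtain ⟨ρ, hρ⟩ := p.exists_comp_eq_of_ker_le hp (p ∘ₗ K.subtype ∘ₗ r') <| by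
      intro q hq
      have hqK : q ∈ K := ⟨0, by rw [map_zero, LinearMap.mem_ker.1 hq]⟩
      change p (r' q) = 0
      rw [hr' ⟨q, hqK⟩]
      exact hq
    have hρ' (q : P) : ρ (p q) = p (r' q) := LinearMap.congr_fun hρ q
    have hρf : ρ ∘ₗ f = f := LinearMap.ext fun y => by
      obtain ⟨q, hq⟩ := hp (f y)
      have hqK : q ∈ K := ⟨y, hq.symm⟩
      rw [LinearMap.comp_apply, ← hq, hρ', hr' ⟨q, hqK⟩]
    intro x
    obtain ⟨x', rfl⟩ := (hmin ρ hρf).2 x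
    obtain ⟨q, rfl⟩ := hp x'
    rw [hρ']
    exact (r' q).2
  -- The pushout map b : Y → V factors through f, so it kills ker f, where it equals a g with a
  -- injective.
  have hzero (Z : FinMod k R) (hZ : ExtClosure S Z) (g : LinearMap.ker f →ₗ[R] Z) : g = 0 := by
    obtain ⟨V, hV, a, b, π, ha, -, -, hb⟩ := exists_pushout hf.1 hZ f hsurj g
    obtain ⟨w, rfl⟩ := hf.2 V b hV
    refine LinearMap.ext fun q => ha ?_
    rw [← hb, LinearMap.comp_apply, LinearMap.mem_ker.1 q.2, map_zero, LinearMap.zero_apply,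
      map_zero]
  have hK : StablyZero (of k (LinearMap.ker f)) := hS.stablyZero fun i g => by
    rw [hzero (S i) (.of_member i) g]
    exact (projMaps _ _).zero_mem
  have hid := hzero (of k (LinearMap.ker f)) (.of_stage (n := 0) hK) LinearMap.id
  have hinj : Function.Injective f := by
    rw [injective_iff_map_eq_zero]
    intro y hy
    exact congrArg Subtype.val (LinearMap.congr_fun hid ⟨y, hy⟩)
  exact hf.1.congr (LinearEquiv.ofBijective f ⟨hinj, hsurj⟩).symm

end FinMod

theorem theorem3p7
    {k : Type v} {R : Type u} [Field k] [IsAlgClosed k] [Ring R] [Algebra k R]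
    [FiniteDimensional k R]
    {ι : Type w} (S : ι → FinMod.{u, v} k R) (hS : FinMod.IsOrthogonalSystem S)
    {J : Type x} (N : J → FinMod.{u, v} k R)
    (hN : ∀ j, FinMod.ExtClosure S (N j))
    (hN' : ∀ X : FinMod.{u, v} k R, FinMod.ExtClosure S X →
      ∃ j, Nonempty (X ≃ₗ[R] N j))
    (hcoh : EndRightCoherent R (DirectSum J (fun j => (N j).carrier)))
    (hfin : IsFinendo R (DirectSum J (fun j => (N j).carrier))) :
    FinMod.CovariantlyFinite (FinMod.ExtClosure S) ∧
    (FinMod.IsWSMS S → (∀ i, ¬ FinMod.InHomogeneousTube (S i)) → FinMod.IsSMS S) := by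
  have : IsNoetherianRing R := IsNoetherianRing.of_finite k R
  have : IsArtinianRing R := IsArtinianRing.of_finite k R
  have happ := FinMod.exists_approximation hN hN' hcoh hfin
  refine ⟨fun Y => ?_, fun hw _ => ⟨hS, fun Y => ?_⟩⟩
  · obtain ⟨X, hX, f, hf⟩ := happ Y
    refine ⟨X, f, hX, fun X' g hX' => ?_⟩
    obtain ⟨h, rfl⟩ := hf X' g hX'
    exact ⟨h, .refl _⟩
  · obtain ⟨X, hX, f, hf⟩ := happ Y
    exact hw.extClosure_of_approx ⟨X, f, hX, hf⟩
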